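/- Let $n\ge 1$ and $d\ge 0$ be integers, and let $\mathrm{Sp}_{2n}(\mathbb C)$ be the group of complex $2n\times 2n$ matrices preserving the standard form $\Omega=\begin{bmatrix}0&I_n\\-I_n&0\end{bmatrix}$. For a symmetric $n\times n$ matrix $Z$ and an upper unitriangular $n\times n$ matrix $A$ (upper triangular with ones on the diagonal) put $$M^-(Z)=\begin{bmatrix}I_n&0\\Z&I_n\end{bmatrix},\quad M^+(Z)=\begin{bmatrix}I_n&Z\\0&I_n\end{bmatrix},\quad M^-(A,Z)=M^-(Z)\begin{bmatrix}A^{-T}&0\\0&A\end{bmatrix},\quad M^+(A,Z)=M^+(Z)\begin{bmatrix}A^{-1}&0\\0&A^{T}\end{bmatrix}.$$ The matrices $M^\pm(Z)$ are the unitriangular $\Omega$-symplectic matrices; the matrices $M^\pm(A,Z)$ are, after reversing the order of the last $n$ basis vectors, the unitriangular symplectic matrices for the form $\tilde\Omega=\begin{bmatrix}0&L_n\\-L_n&0\end{bmatrix}$, where $L_n$ is the $n\times n$ matrix with ones along the skew-diagonal and zeros elsewhere. Let $K_{symp}(n,d)$ be the smallest natural number $K$ such that for every reduced Stein space $X$ of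 dimension $d$ and every null-homotopic holomorphic map $f:X\to\mathrm{Sp}_{2n}(\mathbb C)$ there are holomorphic maps $Z_1,\dots,Z_K$ from $X$ to the symmetric $n\times n$ matrices with $$f(x)=M^-(Z_1(x))\,M^+(Z_2(x))\cdots M^{\pm}(Z_K(x))\qquad(x\in X).$$ Let $\tilde K_{symp}(n,d)$ be the smallest natural number $K$ such that for all such $X$ and $f$ there are holomorphic maps $A_1,\dots,A_K$ from $X$ to the upper unitriangular and $Z_1,\dots,Z_K$ from $X$ to the symmetric $n\times n$ matrices with $$f(x)=M^-(A_1(x),Z_1(x))\,M^+(A_2(x),Z_2(x))\cdots M^{\pm}(A_K(x),Z_K(x))\qquad(x\in X).$$ (Either number is $\infty$ if there is no such $K$.) Then for every $n\ge 4$ $$K_{symp}(n,d)\le 7\,\tilde K_{symp}(n,d)\ \text{ for all } d\ge 0,\qquad\text{and}\qquad 6\le K_{symp}(n,d)\ \text{ for all } d\ge 1,$$ and for $n=2$ and $n=3$ $$K_{symp}(n,d)\le 4\,\tilde K_{symp}(n,d)\ \text{ for all } d\ge 0.$$ -/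

import Mathlib

/-! ### Reduced complex spaces -/

/-- `A` is an analytic subset of the open set `W ⊆ ℂᴺ`: near every point of `W` it is the common
zero set of finitely many holomorphic functions. -/
def IsAnalyticSubset {N : ℕ} (W A : Set (Fin N → ℂ)) : Prop :=
  IsOpen W ∧ A ⊆ W ∧ ∀ z ∈ W, ∃ V : Set (Fin N → ℂ), IsOpen V ∧ z ∈ V ∧ V ⊆ W ∧
    ∃ (m : ℕ) (g : Fin m → (Fin N → ℂ) → ℂ), (∀ i, AnalyticOnNhd ℂ (g i) V) ∧
      A ∩ V = {w ∈ V | ∀ i, g i w = 0}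

/-- `HolAt f y` is read as "the germ of `f` at `y` is holomorphic". The map `φ` is a chart on the
open set `U` for this notion of holomorphy if it is a homeomorphism of `U` onto its image in `ℂᴺ`
under which the holomorphic germs are exactly the restrictions to the image of germs of
holomorphic functions on `ℂᴺ`. -/
def IsHolChart {X : Type*} [TopologicalSpace X] (HolAt : (X → ℂ) → X → Prop) {N : ℕ}
    (U : Set X) (φ : X → (Fin N → ℂ)) : Prop :=
  IsOpen U ∧ Topology.IsEmbedding (U.domRestrict φ) ∧
    ∀ y ∈ U, ∀ f : X → ℂ, HolAt f y ↔
      ∃ g : (Fin N → ℂ) → ℂ, AnalyticAt ℂ g (φ y) ∧ f =ᶠ[nhds y] g ∘ φ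

/-- The structure of a reduced complex space on a topological space `X`: a sheaf of complex-valued
functions, given by its germs `HolAt`, which is locally isomorphic to an analytic subset `A` of an
open subset of some `ℂᴺ` with the restrictions of holomorphic functions to `A`. -/
structure ReducedComplexStructure (X : Type*) [TopologicalSpace X] where
  /-- The germ of the function at the point is holomorphic. -/
  HolAt : (X → ℂ) → X → Prop
  exists_chart : ∀ x : X, ∃ (N : ℕ) (U : Set X) (φ : X → (Fin N → ℂ)) (W : Set (Fin N → ℂ)),
    x ∈ U ∧ IsHolChart HolAt U φ ∧ IsAnalyticSubset W (φ '' U)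

namespace ReducedComplexStructure

variable {X : Type*} [TopologicalSpace X] (𝒪 : ReducedComplexStructure X)

/-- Holomorphic functions on `X`. -/
def Hol (f : X → ℂ) : Prop := ∀ x, 𝒪.HolAt f x

/-- Holomorphic matrix-valued maps on `X`. -/
def HolMatrix {m n : Type*} (F : X → Matrix m n ℂ) : Prop :=
  ∀ i j, 𝒪.Hol fun x => F x i j

/-- `x` is a regular point of dimension `k`: a neighbourhood of `x` is biholomorphic to an open
subset of `ℂᵏ`. -/
def IsRegularPoint (x : X) (k : ℕ) : Prop :=
  ∃ (U : Set X) (φ : X → (Fin k → ℂ)), x ∈ U ∧ IsHolChart 𝒪.HolAt U φ ∧ IsOpen (φ '' U)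

/-- `X` has dimension `d`: the largest dimension of `X` at its regular points (these form a dense
subset of a reduced complex space) is `d`. -/
def HasDim (d : ℕ) : Prop := IsGreatest {k : ℕ | ∃ x, 𝒪.IsRegularPoint x k} d

/-- The holomorphically convex hull of `K`. -/
def hull (K : Set X) : Set X :=
  {x | ∀ f, 𝒪.Hol f → ∀ C : ℝ, (∀ y ∈ K, ‖f y‖ ≤ C) → ‖f x‖ ≤ C}

/-- `X` is a Stein space: it is Hausdorff with countable topology, holomorphically convex and
holomorphically separable. -/
structure IsStein : Prop where
  t2 : T2Space X
  secondCountable : SecondCountableTopology X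
  convex : ∀ K : Set X, IsCompact K → IsCompact (𝒪.hull K)
  separable : ∀ x y : X, x ≠ y → ∃ f, 𝒪.Hol f ∧ f x ≠ f y

end ReducedComplexStructure

/-! ### Unitriangular factors -/

section Factors

variable {n : ℕ}

/-- `M⁻(Z)`, lower unitriangular for `Ω = [0, I; -I, 0]` when `Z` is symmetric. -/
def Mminus (Z : Matrix (Fin n) (Fin n) ℂ) : Matrix (Fin n ⊕ Fin n) (Fin n ⊕ Fin n) ℂ :=
  Matrix.fromBlocks 1 0 Z 1

/-- `M⁺(Z)`, upper unitriangular for `Ω` when `Z` is symmetric. -/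
def Mplus (Z : Matrix (Fin n) (Fin n) ℂ) : Matrix (Fin n ⊕ Fin n) (Fin n ⊕ Fin n) ℂ :=
  Matrix.fromBlocks 1 Z 0 1

/-- `A` is upper triangular with ones on the diagonal. -/
def IsUpperUnitriangular (A : Matrix (Fin n) (Fin n) ℂ) : Prop :=
  (∀ i, A i i = 1) ∧ ∀ i j, j < i → A i j = 0

/-- `M⁻(A, Z)`: for `A` upper unitriangular and `Z` symmetric these are the matrices that become
the lower unitriangular `Ω̃`-symplectic ones after reversing the last `n` basis vectors, where
`Ω̃ = [0, L; -L, 0]` with `L` the matrix with ones along the skew-diagonal. -/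
noncomputable def MminusTilde (A Z : Matrix (Fin n) (Fin n) ℂ) :
    Matrix (Fin n ⊕ Fin n) (Fin n ⊕ Fin n) ℂ :=
  Matrix.fromBlocks 1 0 Z 1 * Matrix.fromBlocks (A⁻¹).transpose 0 0 A

/-- `M⁺(A, Z)`: the same for upper unitriangular `Ω̃`-symplectic matrices. -/
noncomputable def MplusTilde (A Z : Matrix (Fin n) (Fin n) ℂ) :
    Matrix (Fin n ⊕ Fin n) (Fin n ⊕ Fin n) ℂ :=
  Matrix.fromBlocks 1 Z 0 1 * Matrix.fromBlocks A⁻¹ 0 0 A.transpose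

/-- `f = M⁻(Z₁) M⁺(Z₂) M⁻(Z₃) ⋯` with `K` factors and holomorphic symmetric `Z₁, …, Z_K`. (The
index `k` starts at `0`, so the even `k` carry the lower factors.) -/
def FactorsOmega {X : Type*} [TopologicalSpace X] (𝒪 : ReducedComplexStructure X)
    (f : X → Matrix (Fin n ⊕ Fin n) (Fin n ⊕ Fin n) ℂ) (K : ℕ) : Prop :=
  ∃ Z : Fin K → X → Matrix (Fin n) (Fin n) ℂ,
    (∀ k, 𝒪.HolMatrix (Z k)) ∧ (∀ k x, (Z k x).IsSymm) ∧
    ∀ x, f x = (List.ofFn fun k : Fin K =>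
      if Even (k : ℕ) then Mminus (Z k x) else Mplus (Z k x)).prod

/-- `f = M⁻(A₁, Z₁) M⁺(A₂, Z₂) M⁻(A₃, Z₃) ⋯` with `K` factors, holomorphic upper unitriangular
`A₁, …, A_K` and holomorphic symmetric `Z₁, …, Z_K`. -/
def FactorsOmegaTilde {X : Type*} [TopologicalSpace X] (𝒪 : ReducedComplexStructure X)
    (f : X → Matrix (Fin n ⊕ Fin n) (Fin n ⊕ Fin n) ℂ) (K : ℕ) : Prop :=
  ∃ A Z : Fin K → X → Matrix (Fin n) (Fin n) ℂ,
    (∀ k, 𝒪.HolMatrix (A k)) ∧ (∀ k x, IsUpperUnitriangular (A k x)) ∧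
    (∀ k, 𝒪.HolMatrix (Z k)) ∧ (∀ k x, (Z k x).IsSymm) ∧
    ∀ x, f x = (List.ofFn fun k : Fin K =>
      if Even (k : ℕ) then MminusTilde (A k x) (Z k x) else MplusTilde (A k x) (Z k x)).prod

end Factors

/-- On every `d`-dimensional reduced Stein space, every null-homotopic holomorphic map to
`Sp₂ₙ(ℂ)` is a product of `K` unitriangular factors for `Ω`. (Spaces in `Type` are all there are up
to isomorphism, since a second countable Hausdorff space has at most continuum many points.) -/
def SufficesOmega (n d K : ℕ) : Prop :=
  ∀ (X : Type) [TopologicalSpace X] (𝒪 : ReducedComplexStructure X), 𝒪.IsStein → 𝒪.HasDim d →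
    ∀ f : C(X, Matrix.symplecticGroup (Fin n) ℂ), f.Nullhomotopic →
      𝒪.HolMatrix (fun x => (f x : Matrix (Fin n ⊕ Fin n) (Fin n ⊕ Fin n) ℂ)) →
      FactorsOmega 𝒪 (fun x => (f x : Matrix (Fin n ⊕ Fin n) (Fin n ⊕ Fin n) ℂ)) K

/-- On every `d`-dimensional reduced Stein space, every null-homotopic holomorphic map to
`Sp₂ₙ(ℂ)` is a product of `K` unitriangular factors for `Ω̃`. -/
def SufficesOmegaTilde (n d K : ℕ) : Prop :=
  ∀ (X : Type) [TopologicalSpace X] (𝒪 : ReducedComplexStructure X), 𝒪.IsStein → 𝒪.HasDim d →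
    ∀ f : C(X, Matrix.symplecticGroup (Fin n) ℂ), f.Nullhomotopic →
      𝒪.HolMatrix (fun x => (f x : Matrix (Fin n ⊕ Fin n) (Fin n ⊕ Fin n) ℂ)) →
      FactorsOmegaTilde 𝒪 (fun x => (f x : Matrix (Fin n ⊕ Fin n) (Fin n ⊕ Fin n) ℂ)) K

/-- The minimal number of unitriangular factors for `Ω` (`⊤` if no number suffices). -/
noncomputable def Ksymp (n d : ℕ) : ℕ∞ := ⨅ (K : ℕ) (_ : SufficesOmega n d K), (K : ℕ∞)

/-- The minimal number of unitriangular factors for `Ω̃` (`⊤` if no number suffices). -/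
noncomputable def KsympTilde (n d : ℕ) : ℕ∞ := ⨅ (K : ℕ) (_ : SufficesOmegaTilde n d K), (K : ℕ∞)

/-! Upper bounds. A factor M^±(A, Z) is an elementary factor times a block diagonal matrix built
from A or its inverse, so only block diagonal matrices need to be expanded. If Q is invertible and Q
- 1 = YZ with Y, Z symmetric and holomorphic, block elimination writes the diagonal matrix of Q as
four alternating elementary factors (`SymmetricProduct.alternatingProduct`).

Every square matrix is a product of two symmetric ones, but in general not holomorphically in
parameters. It is so for Hessenberg matrices with unit subdiagonal, because the first basis vector
is cyclic for all of them at once, and the last covector likewise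
(`symmetricProduct_of_isUnitHessenberg`). With N the subdiagonal shift and A unitriangular, A = (A(1
+ N))(1 + N)⁻¹, and both A(1 + N) - 1 and N are of this kind. This gives 4 + 4 factors, two of which
merge, hence 7. For n = 2, 3 the matrix A - 1 is itself a product of two symmetric matrices, hence
4.

Lower bound. If diag(A⁻ᵀ, A) is a product of five factors, then A - 1 = Z₃Z₄ with Z₃, Z₄ symmetric.
Take A = 2 + N(z) on ℂᵈ, where N(z) = z E₀₁ + z² E₁₂ and z is a coordinate. Then N(z)Z₃ is
symmetric, and this forces Z₃ to be singular at z = 0, although Z₃Z₄ = 1 there. -/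

open Matrix

/-! ### Holomorphic functions on a reduced complex space -/

namespace ReducedComplexStructure

variable {X : Type*} [TopologicalSpace X] {𝒪 : ReducedComplexStructure X}

theorem hol_const (c : ℂ) : 𝒪.Hol fun _ => c := by
  intro x
  obtain ⟨N, U, φ, W, hx, hφ, -⟩ := 𝒪.exists_chart x
  exact (hφ.2.2 x hx _).2 ⟨fun _ => c, analyticAt_const, .rfl⟩

theorem Hol.add {f g : X → ℂ} (hf : 𝒪.Hol f) (hg : 𝒪.Hol g) : 𝒪.Hol fun x => f x + g x := by
  intro x
  obtain ⟨N, U, φ, W, hx, hφ, -⟩ := 𝒪.exists_chart x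
  obtain ⟨F, hF, hfF⟩ := (hφ.2.2 x hx f).1 (hf x)
  obtain ⟨G, hG, hgG⟩ := (hφ.2.2 x hx g).1 (hg x)
  exact (hφ.2.2 x hx _).2 ⟨fun z => F z + G z, hF.fun_add hG, hfF.add hgG⟩

theorem Hol.mul {f g : X → ℂ} (hf : 𝒪.Hol f) (hg : 𝒪.Hol g) : 𝒪.Hol fun x => f x * g x := by
  intro x
  obtain ⟨N, U, φ, W, hx, hφ, -⟩ := 𝒪.exists_chart x
  obtain ⟨F, hF, hfF⟩ := (hφ.2.2 x hx f).1 (hf x)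
  obtain ⟨G, hG, hgG⟩ := (hφ.2.2 x hx g).1 (hg x)
  exact (hφ.2.2 x hx _).2 ⟨fun z => F z * G z, hF.fun_mul hG, hfF.mul hgG⟩

theorem Hol.inv {f : X → ℂ} (hf : 𝒪.Hol f) (h0 : ∀ x, f x ≠ 0) : 𝒪.Hol fun x => (f x)⁻¹ := by
  intro x
  obtain ⟨N, U, φ, W, hx, hφ, -⟩ := 𝒪.exists_chart x
  obtain ⟨F, hF, hfF⟩ := (hφ.2.2 x hx f).1 (hf x)
  have hFx : F (φ x) ≠ 0 := by
    have := hfF.self_of_nhds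
    simp only [Function.comp_apply] at this
    exact this ▸ h0 x
  exact (hφ.2.2 x hx _).2 ⟨fun z => (F z)⁻¹, hF.fun_inv hFx, hfF.inv⟩

theorem hol_sum {ι : Type*} (s : Finset ι) {f : ι → X → ℂ} (hf : ∀ i ∈ s, 𝒪.Hol (f i)) :
    𝒪.Hol fun x => ∑ i ∈ s, f i x := by
  classical
  induction s using Finset.induction_on with
  | empty => simpa using hol_const 0
  | insert a s ha ih =>
    simp only [Finset.sum_insert ha]
    exact (hf a (by simp)).add (ih fun i hi => hf i (by simp [hi]))

theorem hol_prod {ι : Type*} (s : Finset ι) {f : ι → X → ℂ} (hf : ∀ i ∈ s, 𝒪.Hol (f i)) :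
    𝒪.Hol fun x => ∏ i ∈ s, f i x := by
  classical
  induction s using Finset.induction_on with
  | empty => simpa using hol_const 1
  | insert a s ha ih =>
    simp only [Finset.prod_insert ha]
    exact (hf a (by simp)).mul (ih fun i hi => hf i (by simp [hi]))

variable {l m n : Type*}

theorem holMatrix_const (M : Matrix m n ℂ) : 𝒪.HolMatrix fun _ => M := fun i j => hol_const (M i j)

theorem HolMatrix.add {F G : X → Matrix m n ℂ} (hF : 𝒪.HolMatrix F) (hG : 𝒪.HolMatrix G) :
    𝒪.HolMatrix fun x => F x + G x := fun i j => (hF i j).add (hG i j)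

theorem HolMatrix.neg {F : X → Matrix m n ℂ} (hF : 𝒪.HolMatrix F) :
    𝒪.HolMatrix fun x => -F x := fun i j => by
  simpa using (hol_const (𝒪 := 𝒪) (-1)).mul (hF i j)

theorem HolMatrix.sub {F G : X → Matrix m n ℂ} (hF : 𝒪.HolMatrix F) (hG : 𝒪.HolMatrix G) :
    𝒪.HolMatrix fun x => F x - G x := by
  simpa only [sub_eq_add_neg] using hF.add hG.neg

theorem HolMatrix.mul [Fintype m] {F : X → Matrix l m ℂ} {G : X → Matrix m n ℂ}
    (hF : 𝒪.HolMatrix F) (hG : 𝒪.HolMatrix G) : 𝒪.HolMatrix fun x => F x * G x := fun i j => by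
  simpa only [Matrix.mul_apply] using hol_sum _ fun k _ => (hF i k).mul (hG k j)

theorem HolMatrix.transpose {F : X → Matrix m n ℂ} (hF : 𝒪.HolMatrix F) :
    𝒪.HolMatrix fun x => (F x)ᵀ := fun i j => hF j i

variable [Fintype n] [DecidableEq n]

theorem HolMatrix.pow {F : X → Matrix n n ℂ} (hF : 𝒪.HolMatrix F) (k : ℕ) :
    𝒪.HolMatrix fun x => F x ^ k := by
  induction k with
  | zero => simpa using holMatrix_const 1
  | succ k ih => simpa only [pow_succ] using ih.mul hF

theorem HolMatrix.det {F : X → Matrix n n ℂ} (hF : 𝒪.HolMatrix F) :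
    𝒪.Hol fun x => (F x).det := by
  simp only [Matrix.det_apply']
  exact hol_sum _ fun σ _ => (hol_const _).mul (hol_prod _ fun i _ => hF _ _)

theorem HolMatrix.inv {F : X → Matrix n n ℂ} (hF : 𝒪.HolMatrix F) (h0 : ∀ x, (F x).det ≠ 0) :
    𝒪.HolMatrix fun x => (F x)⁻¹ := by
  intro i j
  simp only [Matrix.inv_def, Ring.inverse_eq_inv', Matrix.smul_apply, smul_eq_mul,
    Matrix.adjugate_apply]
  refine (hF.det.inv h0).mul (HolMatrix.det fun a b => ?_)
  by_cases h : a = j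
  · subst h
    simpa using hol_const _
  · simpa [Matrix.updateRow_ne h] using hF a b

end ReducedComplexStructure

open ReducedComplexStructure

/-! ### Alternating products of unitriangular symplectic matrices -/

section Alternating

variable {n : ℕ} {X : Type*} [TopologicalSpace X] {𝒪 : ReducedComplexStructure X}

/-- `M⁺(Z)` or `M⁻(Z)`, according to the sign. -/
def elementaryFactor (s : Bool) (Z : Matrix (Fin n) (Fin n) ℂ) :
    Matrix (Fin n ⊕ Fin n) (Fin n ⊕ Fin n) ℂ := if s then Mplus Z else Mminus Z

/-- The block diagonal symplectic matrix with block `Q` in the lower right corner, or in the upper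
left corner, according to the sign. -/
noncomputable def diagonalFactor (s : Bool) (Q : Matrix (Fin n) (Fin n) ℂ) :
    Matrix (Fin n ⊕ Fin n) (Fin n ⊕ Fin n) ℂ :=
  if s then fromBlocks Q 0 0 (Q⁻¹)ᵀ else fromBlocks (Q⁻¹)ᵀ 0 0 Q

/-- `f` is an alternating product of `K` elementary factors with holomorphic symmetric parameters,
starting with sign `s`. -/
def AlternatingProduct (𝒪 : ReducedComplexStructure X) :
    Bool → ℕ → (X → Matrix (Fin n ⊕ Fin n) (Fin n ⊕ Fin n) ℂ) → Prop
  | _, 0, f => ∀ x, f x = 1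
  | s, K + 1, f => ∃ (Z : X → Matrix (Fin n) (Fin n) ℂ)
      (g : X → Matrix (Fin n ⊕ Fin n) (Fin n ⊕ Fin n) ℂ), 𝒪.HolMatrix Z ∧ (∀ x, (Z x).IsSymm) ∧
      AlternatingProduct 𝒪 (!s) K g ∧ ∀ x, f x = elementaryFactor s (Z x) * g x

theorem elementaryFactor_zero (s : Bool) :
    elementaryFactor s (0 : Matrix (Fin n) (Fin n) ℂ) = 1 := by
  cases s <;> simp [elementaryFactor, Mplus, Mminus]

theorem elementaryFactor_add (s : Bool) (Y Z : Matrix (Fin n) (Fin n) ℂ) :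
    elementaryFactor s (Y + Z) = elementaryFactor s Y * elementaryFactor s Z := by
  cases s <;> simp [elementaryFactor, Mplus, Mminus, fromBlocks_multiply, add_comm]

variable {f g : X → Matrix (Fin n ⊕ Fin n) (Fin n ⊕ Fin n) ℂ}

theorem AlternatingProduct.succ {s : Bool} {K : ℕ} (h : AlternatingProduct 𝒪 s K f) :
    AlternatingProduct 𝒪 s (K + 1) f := by
  induction K generalizing s f with
  | zero =>
    exact ⟨fun _ => 0, f, holMatrix_const 0, fun _ => isSymm_zero, h,
      fun x => by rw [elementaryFactor_zero, one_mul]⟩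
  | succ K ih =>
    obtain ⟨Z, g, hZ, hZs, hg, hf⟩ := h
    exact ⟨Z, g, hZ, hZs, ih hg, hf⟩

theorem AlternatingProduct.mono {s : Bool} {K L : ℕ} (h : AlternatingProduct 𝒪 s K f)
    (hKL : K ≤ L) : AlternatingProduct 𝒪 s L f := by
  induction L, hKL using Nat.le_induction with
  | base => exact h
  | succ L _ ih => exact ih.succ

theorem AlternatingProduct.elementaryFactor_mul {s : Bool} {K : ℕ}
    (h : AlternatingProduct 𝒪 s (K + 1) f) {Z : X → Matrix (Fin n) (Fin n) ℂ}
    (hZ : 𝒪.HolMatrix Z) (hZs : ∀ x, (Z x).IsSymm) :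
    AlternatingProduct 𝒪 s (K + 1) fun x => elementaryFactor s (Z x) * f x := by
  obtain ⟨Y, g, hY, hYs, hg, hf⟩ := h
  exact ⟨fun x => Z x + Y x, g, hZ.add hY, fun x => (hZs x).add (hYs x), hg,
    fun x => by simp only [hf, elementaryFactor_add, mul_assoc]⟩

/-- Concatenation; the second product starts with the sign that comes after the last factor of the
first one. -/
theorem AlternatingProduct.mul {s : Bool} {K L : ℕ} (hf : AlternatingProduct 𝒪 s K f)
    (hg : AlternatingProduct 𝒪 (not^[K] s) L g) :
    AlternatingProduct 𝒪 s (K + L) fun x => f x * g x := by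
  induction K generalizing s f with
  | zero =>
    have hf' : ∀ x, f x = 1 := hf
    simpa [hf'] using hg
  | succ K ih =>
    obtain ⟨Z, h, hZ, hZs, hh, hf⟩ := hf
    rw [Nat.succ_add]
    exact ⟨Z, _, hZ, hZs, ih hh hg, fun x => by simp only [hf, mul_assoc]⟩

/-- Concatenation with merging; the second product starts with the sign of the last factor of the
first one. -/
theorem AlternatingProduct.mul_merge {s : Bool} {K L : ℕ} (hf : AlternatingProduct 𝒪 s (K + 1) f)
    (hg : AlternatingProduct 𝒪 (not^[K] s) (L + 1) g) :
    AlternatingProduct 𝒪 s (K + L + 1) fun x => f x * g x := by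
  induction K generalizing s f with
  | zero =>
    obtain ⟨Z, h, hZ, hZs, hh, hf⟩ := hf
    have hh' : ∀ x, h x = 1 := hh
    simpa [hf, hh'] using hg.elementaryFactor_mul hZ hZs
  | succ K ih =>
    obtain ⟨Z, h, hZ, hZs, hh, hf⟩ := hf
    rw [show K + 1 + L + 1 = K + L + 1 + 1 by ring]
    exact ⟨Z, _, hZ, hZs, ih hh hg, fun x => by simp only [hf, mul_assoc]⟩

theorem alternatingProduct_iff (s : Bool) (K : ℕ) : AlternatingProduct 𝒪 s K f ↔
    ∃ Z : Fin K → X → Matrix (Fin n) (Fin n) ℂ,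
      (∀ k, 𝒪.HolMatrix (Z k)) ∧ (∀ k x, (Z k x).IsSymm) ∧
      ∀ x, f x = (List.ofFn fun k : Fin K => elementaryFactor (not^[k] s) (Z k x)).prod := by
  induction K generalizing s f with
  | zero => simp [AlternatingProduct]
  | succ K ih =>
    constructor
    · rintro ⟨Z, g, hZ, hZs, hg, hf⟩
      obtain ⟨Y, hY, hYs, hgY⟩ := (ih _).1 hg
      refine ⟨Fin.cons Z Y, Fin.cases hZ hY, Fin.cases hZs hYs, fun x => ?_⟩
      simp [hf, hgY, List.ofFn_succ]
    · rintro ⟨Z, hZ, hZs, hf⟩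
      exact ⟨Z 0, _, hZ 0, hZs 0, (ih _).2 ⟨fun k => Z k.succ, fun k => hZ _, fun k => hZs _,
        fun x => rfl⟩, fun x => by simp [hf, List.ofFn_succ]⟩

theorem not_iterate_false (k : ℕ) : not^[k] false = !decide (Even k) := by
  induction k with
  | zero => simp
  | succ k ih => simp [Function.iterate_succ_apply', ih, Nat.even_add_one, -Nat.not_even_iff_odd]

theorem factorsOmega_iff (K : ℕ) : FactorsOmega 𝒪 f K ↔ AlternatingProduct 𝒪 false K f := by
  simp [alternatingProduct_iff, FactorsOmega, not_iterate_false, elementaryFactor,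
    -Nat.not_even_iff_odd]

/-! ### Block diagonal matrices as alternating products -/

/-- The first two factors multiply to a block matrix with diagonal blocks Q = 1 + YZ and 1 and
off-diagonal blocks Y and Z. The third factor clears Y and turns the block 1 into the Schur
complement 1 - ZQ⁻¹Y = Q⁻ᵀ, and the fourth clears Z. -/
theorem elementaryFactor_prod_eq_diagonalFactor (s : Bool) {Q Y Z : Matrix (Fin n) (Fin n) ℂ}
    (hQ : Q.det ≠ 0) (hY : Y.IsSymm) (hZ : Z.IsSymm) (h : Q = 1 + Y * Z) :
    elementaryFactor s Y * (elementaryFactor (!s) Z * (elementaryFactor s (-(Q⁻¹ * Y)) *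
      elementaryFactor (!s) (-(Qᵀ * Z)))) = diagonalFactor s Q := by
  have hu : IsUnit Q.det := hQ.isUnit
  have hT : Qᵀ = 1 + Z * Y := by
    rw [h, transpose_add, transpose_mul, hY.eq, hZ.eq, transpose_one]
  have hinv : 1 - Z * (Q⁻¹ * Y) = (Q⁻¹)ᵀ := by
    rw [transpose_nonsing_inv]
    refine (inv_eq_left_inv ?_).symm
    -- Both sides equal Y + YZY. The same identity makes Q⁻¹Y symmetric.
    have : Y * Qᵀ = Q * Y := by rw [hT, h]; noncomm_ring
    rw [sub_mul, Matrix.mul_assoc, Matrix.mul_assoc, this, nonsing_inv_mul_cancel_left _ _ hu, hT]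
    noncomm_ring
  have hTL : 1 + Z * -(Q⁻¹ * Y) = (Q⁻¹)ᵀ := by rw [← hinv]; noncomm_ring
  have hBL : Y + Q * -(Q⁻¹ * Y) = 0 := by
    rw [Matrix.mul_neg, mul_nonsing_inv_cancel_left _ _ hu, add_neg_cancel]
  have hTR : Z + (Q⁻¹)ᵀ * -(Qᵀ * Z) = 0 := by
    rw [Matrix.mul_neg, transpose_nonsing_inv,
      nonsing_inv_mul_cancel_left _ _ (by rwa [det_transpose]), add_neg_cancel]
  simp only [diagonalFactor]
  clear hinv
  generalize -(Q⁻¹ * Y) = U at *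
  generalize -(Qᵀ * Z) = V at *
  generalize (Q⁻¹)ᵀ = R at *
  -- The identities that follow are the block entries of the right-nested product, in the shapes
  -- needed for the two signs.
  have e1 : Z * (1 + U * V) + V = 0 := by
    rw [← hTR, ← hTL]; noncomm_ring
  have e2 : Y * V + (1 + Y * Z) * (1 + U * V) = Q := by
    have : Y * V + Q * (1 + U * V) = (Y + Q * U) * V + Q := by noncomm_ring
    rw [← h, this, hBL, zero_mul, zero_add]
  have e3 : Y + (1 + Y * Z) * U = 0 := by rw [← h, hBL]
  have e4 : Y * (1 + Z * U) + U = 0 := by rw [← e3]; noncomm_ring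
  have e5 : 1 + U * V + Y * (Z * (1 + U * V) + V) = Q := by rw [← e2]; noncomm_ring
  have e6 : U + Y * (Z * U + 1) = 0 := by rw [← e3]; noncomm_ring
  cases s
  · simpa [elementaryFactor, Mplus, Mminus, fromBlocks_multiply] using
      ⟨hTL, by rw [← e1, add_comm V, add_comm (U * V)], e4, by rw [← e5, add_comm V, add_comm (U * V), add_comm]⟩
  · simpa [elementaryFactor, Mplus, Mminus, fromBlocks_multiply] using
      ⟨e5, e6, e1, by rw [← hTL, add_comm]⟩

/-- A holomorphic matrix that is the product of two holomorphic symmetric ones. -/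
def SymmetricProduct (𝒪 : ReducedComplexStructure X) (H : X → Matrix (Fin n) (Fin n) ℂ) : Prop :=
  ∃ Y Z : X → Matrix (Fin n) (Fin n) ℂ, 𝒪.HolMatrix Y ∧ 𝒪.HolMatrix Z ∧ (∀ x, (Y x).IsSymm) ∧
    (∀ x, (Z x).IsSymm) ∧ ∀ x, H x = Y x * Z x

theorem SymmetricProduct.transpose {H : X → Matrix (Fin n) (Fin n) ℂ}
    (h : SymmetricProduct 𝒪 H) : SymmetricProduct 𝒪 fun x => (H x)ᵀ := by
  obtain ⟨Y, Z, hY, hZ, hYs, hZs, h⟩ := h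
  exact ⟨Z, Y, hZ, hY, hZs, hYs, fun x => by simp only [h, transpose_mul, (hYs x).eq, (hZs x).eq]⟩

theorem SymmetricProduct.alternatingProduct {Q : X → Matrix (Fin n) (Fin n) ℂ} (s : Bool)
    (hQ0 : ∀ x, (Q x).det ≠ 0) (h : SymmetricProduct 𝒪 fun x => Q x - 1) :
    AlternatingProduct 𝒪 s 4 fun x => diagonalFactor s (Q x) := by
  obtain ⟨Y, Z, hY, hZ, hYs, hZs, h⟩ := h
  have hQe : ∀ x, Q x = 1 + Y x * Z x := fun x => by
    rw [← h, add_sub_cancel]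
  have hQT : ∀ x, (Q x)ᵀ = 1 + Z x * Y x := fun x => by
    rw [hQe, transpose_add, transpose_mul, (hYs x).eq, (hZs x).eq, transpose_one]
  have hQ : 𝒪.HolMatrix Q := by
    rw [funext hQe]
    exact (holMatrix_const 1).add (hY.mul hZ)
  refine ⟨Y, _, hY, hYs, ⟨Z, _, hZ, hZs, ⟨fun x => -((Q x)⁻¹ * Y x), _, ((hQ.inv hQ0).mul hY).neg,
    fun x => ?_, ⟨fun x => -((Q x)ᵀ * Z x), _, (hQ.transpose.mul hZ).neg, fun x => ?_,
    fun x => rfl, fun x => rfl⟩, fun x => rfl⟩, fun x => rfl⟩, fun x => ?_⟩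
  · have hu : IsUnit (Q x).det := (hQ0 x).isUnit
    have hc : Y x * (Q x)ᵀ = Q x * Y x := by rw [hQT, hQe]; noncomm_ring
    rw [IsSymm, transpose_neg, transpose_mul, (hYs x).eq, transpose_nonsing_inv, neg_inj]
    have hu' : IsUnit ((Q x)ᵀ).det := by rwa [det_transpose]
    calc Y x * (Q x)ᵀ⁻¹ = (Q x)⁻¹ * (Q x * Y x) * (Q x)ᵀ⁻¹ := by
          rw [nonsing_inv_mul_cancel_left _ _ hu]
      _ = (Q x)⁻¹ * Y x := by
          rw [← hc, ← Matrix.mul_assoc, mul_nonsing_inv_cancel_right _ _ hu']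
  · rw [IsSymm, transpose_neg, transpose_mul, (hZs x).eq, transpose_transpose]
    simp only [hQT]
    rw [hQe]
    noncomm_ring
  · simpa using
      (elementaryFactor_prod_eq_diagonalFactor s (hQ0 x) (hYs x) (hZs x) (hQe x)).symm

theorem diagonalFactor_mul (s : Bool) (P Q : Matrix (Fin n) (Fin n) ℂ) :
    diagonalFactor s (P * Q) = diagonalFactor s P * diagonalFactor s Q := by
  cases s <;> simp [diagonalFactor, fromBlocks_multiply, Matrix.mul_inv_rev]

/-- Lets the expansion of an inverse start with the opposite sign, so that it can merge with a
preceding product of four factors. -/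
theorem diagonalFactor_inv (s : Bool) {Q : Matrix (Fin n) (Fin n) ℂ} (hQ : Q.det ≠ 0) :
    diagonalFactor s Q⁻¹ = diagonalFactor (!s) Qᵀ := by
  cases s <;> simp [diagonalFactor, nonsing_inv_nonsing_inv _ hQ.isUnit, transpose_nonsing_inv]

/-! ### Hessenberg matrices as products of two symmetric matrices -/

/-- Upper Hessenberg matrices with ones on the subdiagonal. -/
def IsUnitHessenberg (H : Matrix (Fin n) (Fin n) ℂ) : Prop :=
  ∀ i j : Fin n, (j.val + 1 < i.val → H i j = 0) ∧ (i.val = j.val + 1 → H i j = 1)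

/-- Each application of H moves a basis vector down by at most one place, and the only way down by k
places in k steps has weight 1. -/
theorem IsUnitHessenberg.pow_apply {H : Matrix (Fin n) (Fin n) ℂ} (hH : IsUnitHessenberg H)
    (k : ℕ) (i j : Fin n) : (j.val + k < i.val → (H ^ k) i j = 0) ∧
      (i.val = j.val + k → (H ^ k) i j = 1) := by
  induction k generalizing i with
  | zero =>
    simp only [add_zero, pow_zero]
    refine ⟨fun h => one_apply_ne (by rintro rfl; omega), fun h => ?_⟩
    rw [Fin.ext h, one_apply_eq]
  | succ k ih =>
    simp only [pow_succ', mul_apply]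
    refine ⟨fun h => Finset.sum_eq_zero fun l _ => ?_, fun h => ?_⟩
    · rcases lt_or_ge (l.val + 1) i.val with hl | hl
      · rw [(hH i l).1 hl, zero_mul]
      · rw [(ih l).1 (by omega), mul_zero]
    · rw [Finset.sum_eq_single ⟨j.val + k, by omega⟩]
      · rw [(hH _ _).2 (by simp; omega), (ih _).2 rfl, one_mul]
      · intro l _ hl
        have hl' : l.val ≠ j.val + k := fun h => hl (Fin.ext h)
        rcases lt_or_ge (l.val + 1) i.val with hl | hl
        · rw [(hH i l).1 hl, zero_mul]
        · rw [(ih l).1 (by omega), mul_zero]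
      · simp

theorem IsUpperUnitriangular.det_eq_one {A : Matrix (Fin n) (Fin n) ℂ}
    (hA : IsUpperUnitriangular A) : A.det = 1 := by
  rw [det_of_isUpperTriangular fun i j h => hA.2 i j h]
  simp [hA.1]

/-- The columns `Hʲ e` for the first basis vector `e`. -/
def krylovColumns {m : ℕ} (H : Matrix (Fin (m + 1)) (Fin (m + 1)) ℂ) :
    Matrix (Fin (m + 1)) (Fin (m + 1)) ℂ := of fun i j => (H ^ (j : ℕ)) i 0

/-- The rows `eᵀ Hⁱ` for the last basis vector `e`. -/
def krylovRows {m : ℕ} (H : Matrix (Fin (m + 1)) (Fin (m + 1)) ℂ) :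
    Matrix (Fin (m + 1)) (Fin (m + 1)) ℂ := of fun i j => (H ^ (i : ℕ)) (Fin.last m) j

theorem det_krylovColumns_ne_zero {m : ℕ} {H : Matrix (Fin (m + 1)) (Fin (m + 1)) ℂ}
    (hH : IsUnitHessenberg H) : (krylovColumns H).det ≠ 0 := by
  rw [IsUpperUnitriangular.det_eq_one]
  · exact one_ne_zero
  · exact ⟨fun i => (hH.pow_apply _ _ _).2 (by simp),
      fun i j hij => (hH.pow_apply _ _ _).1 (by simpa using hij)⟩

theorem det_krylovRows_ne_zero {m : ℕ} {H : Matrix (Fin (m + 1)) (Fin (m + 1)) ℂ}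
    (hH : IsUnitHessenberg H) : (krylovRows H).det ≠ 0 := by
  have h : ((krylovRows H).submatrix Fin.revPerm id).det = 1 := by
    refine IsUpperUnitriangular.det_eq_one ⟨fun i => (hH.pow_apply _ _ _).2 ?_,
      fun i j hij => (hH.pow_apply _ _ _).1 ?_⟩
    · simp [Fin.val_rev]; omega
    · have : j.val < i.val := hij
      simp [Fin.val_rev]; omega
  rw [det_permute] at h
  exact right_ne_zero_of_mul (h ▸ one_ne_zero)

theorem krylovRows_mul_pow_mul_krylovColumns {m : ℕ} (H : Matrix (Fin (m + 1)) (Fin (m + 1)) ℂ)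
    (k : ℕ) (i j : Fin (m + 1)) : (krylovRows H * H ^ k * krylovColumns H) i j =
      (H ^ (i.val + k + j.val)) (Fin.last m) 0 := by
  rw [pow_add, pow_add, mul_apply, mul_apply]
  rfl

/-- The product is a Hankel matrix: its entries depend only on i + j. -/
theorem isSymm_krylovRows_mul_pow_mul_krylovColumns {m : ℕ}
    (H : Matrix (Fin (m + 1)) (Fin (m + 1)) ℂ) (k : ℕ) :
    (krylovRows H * H ^ k * krylovColumns H).IsSymm := by
  ext i j
  rw [transpose_apply, krylovRows_mul_pow_mul_krylovColumns, krylovRows_mul_pow_mul_krylovColumns]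
  rw [show i.val + k + j.val = j.val + k + i.val by ring]

/-- With P the Krylov columns and R the Krylov rows, H = (R⁻¹Pᵀ)(P⁻ᵀ(RHP)P⁻¹). The first factor is
symmetric since RP is Hankel, the second since RHP is. Unit subdiagonals make P and R invertible
everywhere, so nothing in the formula has poles. -/
theorem symmetricProduct_of_isUnitHessenberg {m : ℕ}
    {H : X → Matrix (Fin (m + 1)) (Fin (m + 1)) ℂ} (hH : 𝒪.HolMatrix H)
    (hu : ∀ x, IsUnitHessenberg (H x)) : SymmetricProduct 𝒪 H := by
  have hP : 𝒪.HolMatrix fun x => krylovColumns (H x) := fun i j => hH.pow j i 0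
  have hQ : 𝒪.HolMatrix fun x => krylovRows (H x) := fun i j => hH.pow i (Fin.last m) j
  have hP' := hP.inv fun x => det_krylovColumns_ne_zero (hu x)
  have hQ' := hQ.inv fun x => det_krylovRows_ne_zero (hu x)
  refine ⟨_, _, hQ'.mul hP.transpose, hP'.transpose.mul (((hQ.mul hH).mul hP).mul hP'),
    fun x => ?_, fun x => ?_, fun x => ?_⟩
  all_goals
    have uP := (det_krylovColumns_ne_zero (hu x)).isUnit
    have uQ := (det_krylovRows_ne_zero (hu x)).isUnit
    have s0 := (isSymm_krylovRows_mul_pow_mul_krylovColumns (H x) 0).eq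
    have s1 := (isSymm_krylovRows_mul_pow_mul_krylovColumns (H x) 1).eq
    rw [pow_zero, Matrix.mul_one, transpose_mul] at s0
    rw [pow_one] at s1
    generalize krylovColumns (H x) = P at *
    generalize krylovRows (H x) = Q at *
  · have uQ' : IsUnit Qᵀ.det := by rwa [det_transpose]
    rw [IsSymm, transpose_mul, transpose_transpose, transpose_nonsing_inv]
    calc P * Qᵀ⁻¹ = Q⁻¹ * (Q * P) * Qᵀ⁻¹ := by rw [nonsing_inv_mul_cancel_left _ _ uQ]
      _ = Q⁻¹ * Pᵀ := by rw [← s0, ← Matrix.mul_assoc, mul_nonsing_inv_cancel_right _ _ uQ']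
  · rw [IsSymm, transpose_mul, transpose_mul, s1, transpose_transpose, Matrix.mul_assoc]
  · have uP' : IsUnit Pᵀ.det := by rwa [det_transpose]
    rw [mul_nonsing_inv_cancel_right _ _ uP, Matrix.mul_assoc, transpose_nonsing_inv,
      mul_nonsing_inv_cancel_left _ _ uP', nonsing_inv_mul_cancel_left _ _ uQ]

/-- The nilpotent matrix with ones on the subdiagonal. -/
def subdiagonalShift (n : ℕ) : Matrix (Fin n) (Fin n) ℂ :=
  of fun i j => if i.val = j.val + 1 then 1 else 0

theorem isUnitHessenberg_subdiagonalShift : IsUnitHessenberg (subdiagonalShift n) := fun i j =>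
  ⟨fun h => if_neg (by omega), fun h => if_pos h⟩

theorem det_one_add_subdiagonalShift : (1 + subdiagonalShift n).det = 1 := by
  rw [det_of_isLowerTriangular]
  · simp [subdiagonalShift]
  · intro i j h
    have h' : i.val < j.val := h
    rw [Matrix.add_apply, one_apply_ne (by rintro rfl; omega), zero_add, subdiagonalShift,
      of_apply, if_neg (by omega)]

/-- Right multiplication by 1 + N adds to each column its right neighbour, which puts the unit
diagonal of A onto the subdiagonal. -/
theorem IsUpperUnitriangular.isUnitHessenberg {A : Matrix (Fin n) (Fin n) ℂ}
    (hA : IsUpperUnitriangular A) : IsUnitHessenberg (A * (1 + subdiagonalShift n) - 1) := by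
  have key : ∀ (i j : Fin n) (h : j.val < i.val), (A * (1 + subdiagonalShift n) - 1) i j =
      A i ⟨j.val + 1, lt_of_le_of_lt h i.isLt⟩ := by
    intro i j h
    rw [Matrix.mul_add, Matrix.mul_one, Matrix.sub_apply, Matrix.add_apply, hA.2 i j h,
      one_apply_ne (by rintro rfl; omega), zero_add, sub_zero, mul_apply,
      Finset.sum_eq_single (⟨j.val + 1, lt_of_le_of_lt h i.isLt⟩ : Fin n)]
    · rw [subdiagonalShift, of_apply, if_pos rfl, mul_one]
    · intro l _ hl
      rw [subdiagonalShift, of_apply, if_neg fun h => hl (Fin.ext h), mul_zero]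
    · simp
  intro i j
  refine ⟨fun h => ?_, fun h => ?_⟩
  · rw [key i j (by omega)]
    exact hA.2 _ _ h
  · rw [key i j (by omega), show (⟨j.val + 1, _⟩ : Fin n) = i from Fin.ext h.symm, hA.1]

theorem IsUpperUnitriangular.inv {A : Matrix (Fin n) (Fin n) ℂ} (hA : IsUpperUnitriangular A) :
    IsUpperUnitriangular A⁻¹ := by
  have hu : IsUnit A.det := by simp [hA.det_eq_one]
  let := invertibleOfIsUnitDet A hu
  have ht : BlockTriangular A⁻¹ id := blockTriangular_inv_of_blockTriangular fun i j h => hA.2 i j h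
  refine ⟨fun i => ?_, fun i j h => ht h⟩
  have h : (A * A⁻¹) i i = 1 := by rw [mul_nonsing_inv _ hu, one_apply_eq]
  rwa [mul_apply, Finset.sum_eq_single i, hA.1, one_mul] at h
  · intro j _ hj
    rcases lt_or_gt_of_ne hj with hj | hj
    · rw [hA.2 i j hj, zero_mul]
    · rw [show A⁻¹ j i = 0 from ht hj, mul_zero]
  · simp

/-- With C = 1 + N, the expansion of AC has signs s, !s, s, !s and that of C⁻¹ starts with !s, so
the two adjacent factors merge: 4 + 4 - 1 = 7. -/
theorem alternatingProduct_seven {m : ℕ} {A : X → Matrix (Fin (m + 1)) (Fin (m + 1)) ℂ} (s : Bool)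
    (hA : 𝒪.HolMatrix A) (hu : ∀ x, IsUpperUnitriangular (A x)) :
    AlternatingProduct 𝒪 s 7 fun x => diagonalFactor s (A x) := by
  have hC : (1 + subdiagonalShift (m + 1)).det ≠ 0 := by simp [det_one_add_subdiagonalShift]
  have h1 : AlternatingProduct 𝒪 s 4
      fun x => diagonalFactor s (A x * (1 + subdiagonalShift (m + 1))) := by
    refine SymmetricProduct.alternatingProduct s (fun x => ?_) ?_
    · rw [det_mul, (hu x).det_eq_one, one_mul]
      exact hC
    · exact symmetricProduct_of_isUnitHessenberg
        ((hA.mul (holMatrix_const _)).sub (holMatrix_const 1)) fun x => (hu x).isUnitHessenberg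
  have h2 : AlternatingProduct 𝒪 (!s) 4
      fun _ => diagonalFactor s (1 + subdiagonalShift (m + 1))⁻¹ := by
    rw [diagonalFactor_inv s hC]
    refine SymmetricProduct.alternatingProduct (!s) (fun x => ?_) ?_
    · rwa [det_transpose]
    · have := symmetricProduct_of_isUnitHessenberg (𝒪 := 𝒪)
        (holMatrix_const (subdiagonalShift (m + 1))) fun _ => isUnitHessenberg_subdiagonalShift
      simpa using this.transpose
  have h3 := h1.mul_merge (K := 3) (L := 3) (by simpa using h2)
  simpa [← diagonalFactor_mul, Matrix.mul_assoc, mul_nonsing_inv _ hC.isUnit] using h3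

/-! ### Unitriangular matrices of size two and three -/

theorem symmetricProduct_sub_one_fin_two {A : X → Matrix (Fin 2) (Fin 2) ℂ} (hA : 𝒪.HolMatrix A)
    (hu : ∀ x, IsUpperUnitriangular (A x)) : SymmetricProduct 𝒪 fun x => A x - 1 := by
  refine ⟨fun x => !![A x 0 1, 0; 0, 0], fun _ => !![0, 1; 1, 0], ?_, holMatrix_const _, ?_, ?_, ?_⟩
  · intro i j
    fin_cases i <;> fin_cases j <;> first | exact hA 0 1 | exact hol_const 0
  · intro x
    ext i j
    fin_cases i <;> fin_cases j <;> rfl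
  · intro x
    ext i j
    fin_cases i <;> fin_cases j <;> rfl
  · intro x
    have h0 := (hu x).1
    have h1 := (hu x).2 1 0 (by decide)
    ext i j
    fin_cases i <;> fin_cases j <;> simp [h0, h1]

/-- The left factor swaps the first two rows and kills the third. Hence the last row of the right
factor is free and can be chosen to make it symmetric. -/
theorem symmetricProduct_sub_one_fin_three {A : X → Matrix (Fin 3) (Fin 3) ℂ}
    (hA : 𝒪.HolMatrix A) (hu : ∀ x, IsUpperUnitriangular (A x)) :
    SymmetricProduct 𝒪 fun x => A x - 1 := by
  refine ⟨fun _ => !![0, 1, 0; 1, 0, 0; 0, 0, 0],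
    fun x => !![0, 0, A x 1 2; 0, A x 0 1, A x 0 2; A x 1 2, A x 0 2, 0],
    holMatrix_const _, ?_, ?_, ?_, ?_⟩
  · intro i j
    fin_cases i <;> fin_cases j <;>
      first | exact hol_const 0 | exact hA 0 1 | exact hA 0 2 | exact hA 1 2
  · intro x
    ext i j
    fin_cases i <;> fin_cases j <;> rfl
  · intro x
    ext i j
    fin_cases i <;> fin_cases j <;> rfl
  · intro x
    have h0 := (hu x).1
    have h1 := (hu x).2 1 0 (by decide)
    have h2 := (hu x).2 2 0 (by decide)
    have h3 := (hu x).2 2 1 (by decide)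
    ext i j
    fin_cases i <;> fin_cases j <;> simp [mul_apply, Fin.sum_univ_three, h0, h1, h2, h3]

/-! ### Comparison of the two kinds of factorizations -/

/-- `M⁺(A, Z)` or `M⁻(A, Z)`, according to the sign. -/
noncomputable def tildeFactor (s : Bool) (A Z : Matrix (Fin n) (Fin n) ℂ) :
    Matrix (Fin n ⊕ Fin n) (Fin n ⊕ Fin n) ℂ := if s then MplusTilde A Z else MminusTilde A Z

theorem tildeFactor_eq (s : Bool) {A : Matrix (Fin n) (Fin n) ℂ} (Z : Matrix (Fin n) (Fin n) ℂ)
    (hA : IsUpperUnitriangular A) : tildeFactor s A Z =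
      elementaryFactor s Z * diagonalFactor s (if s then A⁻¹ else A) := by
  have hu : IsUnit A.det := by simp [hA.det_eq_one]
  cases s
  · simp [tildeFactor, MminusTilde, elementaryFactor, diagonalFactor, Mminus]
  · simp [tildeFactor, MplusTilde, elementaryFactor, diagonalFactor, Mplus,
      nonsing_inv_nonsing_inv _ hu]

/-- The elementary part has the same sign as the first factor of the diagonal part and is absorbed
into it at no cost. -/
theorem alternatingProduct_tildeFactor {L : ℕ}
    (hD : ∀ (s : Bool) (A : X → Matrix (Fin n) (Fin n) ℂ), 𝒪.HolMatrix A →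
      (∀ x, IsUpperUnitriangular (A x)) →
      AlternatingProduct 𝒪 s (L + 1) fun x => diagonalFactor s (A x)) (s : Bool)
    {A Z : X → Matrix (Fin n) (Fin n) ℂ} (hA : 𝒪.HolMatrix A)
    (hu : ∀ x, IsUpperUnitriangular (A x)) (hZ : 𝒪.HolMatrix Z) (hZs : ∀ x, (Z x).IsSymm) :
    AlternatingProduct 𝒪 s (L + 1) fun x => tildeFactor s (A x) (Z x) := by
  simp only [fun x => tildeFactor_eq s (Z x) (hu x)]
  refine (hD s (fun x => if s then (A x)⁻¹ else A x) ?_ fun x => ?_).elementaryFactor_mul hZ hZs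
  · cases s
    · simpa using hA
    · simpa using hA.inv fun x => by simp [(hu x).det_eq_one]
  · cases s
    · simpa using hu x
    · simpa using (hu x).inv

theorem alternatingProduct_prod_tildeFactor
    (hD : ∀ (s : Bool) (A : X → Matrix (Fin n) (Fin n) ℂ), 𝒪.HolMatrix A →
      (∀ x, IsUpperUnitriangular (A x)) →
      AlternatingProduct 𝒪 s 7 fun x => diagonalFactor s (A x)) (s : Bool) (K : ℕ)
    {A Z : Fin K → X → Matrix (Fin n) (Fin n) ℂ} (hA : ∀ k, 𝒪.HolMatrix (A k))
    (hu : ∀ k x, IsUpperUnitriangular (A k x)) (hZ : ∀ k, 𝒪.HolMatrix (Z k))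
    (hZs : ∀ k x, (Z k x).IsSymm) : AlternatingProduct 𝒪 s (7 * K) fun x =>
      (List.ofFn fun k : Fin K => tildeFactor (not^[k] s) (A k x) (Z k x)).prod := by
  induction K generalizing s with
  | zero => intro x; simp
  | succ K ih =>
    have h' := ih (!s) (fun k => hA k.succ) (fun k => hu k.succ) (fun k => hZ k.succ)
      fun k => hZs k.succ
    -- Seven is odd, so each block ends with its initial sign and the next block continues the
    -- alternation without merging.
    have h := (alternatingProduct_tildeFactor hD s (hA 0) (hu 0) (hZ 0) (hZs 0)).mul
      (L := 7 * K) (by simpa using h')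
    rw [show 7 * (K + 1) = 6 + 1 + 7 * K by ring]
    simpa [List.ofFn_succ] using h

theorem alternatingProduct_prod_tildeFactor_of_four
    (hD : ∀ (s : Bool) (A : X → Matrix (Fin n) (Fin n) ℂ), 𝒪.HolMatrix A →
      (∀ x, IsUpperUnitriangular (A x)) →
      AlternatingProduct 𝒪 s 4 fun x => diagonalFactor s (A x)) (s : Bool) (K : ℕ)
    {A Z : Fin K → X → Matrix (Fin n) (Fin n) ℂ} (hA : ∀ k, 𝒪.HolMatrix (A k))
    (hu : ∀ k x, IsUpperUnitriangular (A k x)) (hZ : ∀ k, 𝒪.HolMatrix (Z k))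
    (hZs : ∀ k x, (Z k x).IsSymm) : AlternatingProduct 𝒪 s (3 * K + 1) fun x =>
      (List.ofFn fun k : Fin K => tildeFactor (not^[k] s) (A k x) (Z k x)).prod := by
  induction K generalizing s with
  | zero => exact AlternatingProduct.succ (K := 0) fun x => by simp
  | succ K ih =>
    have h' := ih (!s) (fun k => hA k.succ) (fun k => hu k.succ) (fun k => hZ k.succ)
      fun k => hZs k.succ
    -- Four is even, so each block ends with the sign that starts the next one. Merging there leaves
    -- three new factors per block.
    have h := (alternatingProduct_tildeFactor hD s (hA 0) (hu 0) (hZ 0) (hZs 0)).mul_merge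
      (K := 3) (L := 3 * K) (by simpa using h')
    rw [show 3 * (K + 1) + 1 = 3 + 3 * K + 1 by ring]
    simpa [List.ofFn_succ] using h

theorem factorsOmegaTilde_iff (K : ℕ) : FactorsOmegaTilde 𝒪 f K ↔
    ∃ A Z : Fin K → X → Matrix (Fin n) (Fin n) ℂ,
      (∀ k, 𝒪.HolMatrix (A k)) ∧ (∀ k x, IsUpperUnitriangular (A k x)) ∧
      (∀ k, 𝒪.HolMatrix (Z k)) ∧ (∀ k x, (Z k x).IsSymm) ∧
      ∀ x, f x = (List.ofFn fun k : Fin K =>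
        tildeFactor (not^[k] false) (A k x) (Z k x)).prod := by
  simp [FactorsOmegaTilde, not_iterate_false, tildeFactor, -Nat.not_even_iff_odd]

theorem FactorsOmegaTilde.factorsOmega_seven {m K : ℕ}
    {f : X → Matrix (Fin (m + 1) ⊕ Fin (m + 1)) (Fin (m + 1) ⊕ Fin (m + 1)) ℂ}
    (h : FactorsOmegaTilde 𝒪 f K) : FactorsOmega 𝒪 f (7 * K) := by
  obtain ⟨A, Z, hA, hu, hZ, hZs, hf⟩ := (factorsOmegaTilde_iff K).1 h
  rw [factorsOmega_iff, funext hf]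
  exact alternatingProduct_prod_tildeFactor (fun s A => alternatingProduct_seven s) false K
    hA hu hZ hZs

theorem FactorsOmegaTilde.factorsOmega_four {K : ℕ} (hn : n = 2 ∨ n = 3)
    (h : FactorsOmegaTilde 𝒪 f K) : FactorsOmega 𝒪 f (4 * K) := by
  obtain ⟨A, Z, hA, hu, hZ, hZs, hf⟩ := (factorsOmegaTilde_iff K).1 h
  rw [factorsOmega_iff, funext hf]
  -- The bound 3K + 1 ≤ 4K fails for K = 0, where the product is empty.
  rcases K.eq_zero_or_pos with rfl | hK
  · exact fun x => by simp
  · refine (alternatingProduct_prod_tildeFactor_of_four (fun s A hA hu =>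
      SymmetricProduct.alternatingProduct s (fun x => by simp [(hu x).det_eq_one]) ?_) false K
      hA hu hZ hZs).mono (by omega)
    rcases hn with rfl | rfl
    · exact symmetricProduct_sub_one_fin_two hA hu
    · exact symmetricProduct_sub_one_fin_three hA hu

end Alternating

/-! ### Passage to the minimal numbers of factors -/

theorem ksymp_le_mul_ksympTilde {n d c : ℕ} (hc : c ≠ 0)
    (h : ∀ K, SufficesOmegaTilde n d K → SufficesOmega n d (c * K)) :
    Ksymp n d ≤ c * KsympTilde n d := by
  classical
  by_cases hex : ∃ K, SufficesOmegaTilde n d K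
  · have hmin : KsympTilde n d = (Nat.find hex : ℕ∞) := by
      refine le_antisymm (iInf₂_le _ (Nat.find_spec hex)) (le_iInf₂ fun K hK => ?_)
      exact_mod_cast Nat.find_min' hex hK
    rw [hmin]
    exact_mod_cast iInf₂_le (c * Nat.find hex) (h _ (Nat.find_spec hex))
  · have htop : KsympTilde n d = ⊤ := by
      simp only [KsympTilde, iInf_eq_top]
      exact fun K hK => absurd ⟨K, hK⟩ hex
    rw [htop, ENat.mul_top (by exact_mod_cast hc)]
    exact le_top

/-! ### Affine space as a Stein space -/

section Affine

variable {d : ℕ}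

theorem isHolChart_analyticAt_id :
    IsHolChart (fun f x => AnalyticAt ℂ f x) Set.univ (id : (Fin d → ℂ) → (Fin d → ℂ)) := by
  refine ⟨isOpen_univ, (Homeomorph.Set.univ (Fin d → ℂ)).isEmbedding, fun y _ f => ?_⟩
  refine ⟨fun h => ⟨f, h, .rfl⟩, ?_⟩
  rintro ⟨g, hg, hfg⟩
  exact hg.congr hfg.symm

/-- The standard complex structure of `ℂᵈ`. -/
def affineSpace (d : ℕ) : ReducedComplexStructure (Fin d → ℂ) where
  HolAt f x := AnalyticAt ℂ f x
  exists_chart x := ⟨d, Set.univ, id, Set.univ, Set.mem_univ x, isHolChart_analyticAt_id,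
    isOpen_univ, Set.subset_univ _, fun z _ => ⟨Set.univ, isOpen_univ, Set.mem_univ z,
      Set.subset_univ _, 0, Fin.elim0, fun i => i.elim0, by simp⟩⟩

theorem hol_affineSpace_apply (i : Fin d) : (affineSpace d).Hol fun x => x i := fun x =>
  (ContinuousLinearMap.proj (R := ℂ) (φ := fun _ : Fin d => ℂ) i).analyticAt x

theorem continuous_of_hol_affineSpace {f : (Fin d → ℂ) → ℂ} (hf : (affineSpace d).Hol f) :
    Continuous f := continuous_iff_continuousAt.2 fun x => (hf x).continuousAt

theorem isStein_affineSpace : (affineSpace d).IsStein where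
  t2 := inferInstance
  secondCountable := inferInstance
  convex K hK := by
    refine Metric.isCompact_of_isClosed_isBounded ?_ ?_
    · have : (affineSpace d).hull K = ⋂ (f) (_ : (affineSpace d).Hol f) (C : ℝ)
          (_ : ∀ y ∈ K, ‖f y‖ ≤ C), {x | ‖f x‖ ≤ C} := by
        ext x; simp [hull]
      rw [this]
      exact isClosed_iInter fun f => isClosed_iInter fun hf => isClosed_iInter fun C =>
        isClosed_iInter fun _ =>
          isClosed_le (continuous_of_hol_affineSpace hf).norm continuous_const
    -- The coordinate functions bound the hull.
    · obtain ⟨C, hC⟩ := hK.isBounded.exists_norm_le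
      refine isBounded_iff_forall_norm_le.2 ⟨max C 0, fun x hx => ?_⟩
      refine (pi_norm_le_iff_of_nonneg (le_max_right _ _)).2 fun i => ?_
      exact hx _ (hol_affineSpace_apply i) _ fun y hy =>
        (norm_le_pi_norm y i).trans ((hC y hy).trans (le_max_left _ _))
  separable x y hxy := by
    obtain ⟨i, hi⟩ := Function.ne_iff.1 hxy
    exact ⟨_, hol_affineSpace_apply i, hi⟩

/-- The coordinates of ℂᵈ are holomorphic germs, so they factor through the chart and give a
holomorphic left inverse. Since the image of the chart is open, it is also a right inverse near the
image point. By the chain rule the derivative of the chart maps ℂᵈ onto ℂᵏ. -/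
theorem le_of_isRegularPoint_affineSpace {x : Fin d → ℂ} {k : ℕ}
    (h : (affineSpace d).IsRegularPoint x k) : k ≤ d := by
  obtain ⟨U, φ, hx, ⟨hU, hemb, hchart⟩, hopen⟩ := h
  have hφ : AnalyticAt ℂ φ x := by
    refine AnalyticAt.pi fun i => ?_
    exact (hchart x hx fun y => φ y i).2
      ⟨fun z => z i, (ContinuousLinearMap.proj (R := ℂ) (φ := fun _ : Fin k => ℂ) i).analyticAt _,
        .rfl⟩
  have hex : ∀ i : Fin d, ∃ g : (Fin k → ℂ) → ℂ, AnalyticAt ℂ g (φ x) ∧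
      (fun y : Fin d → ℂ => y i) =ᶠ[nhds x] g ∘ φ := fun i =>
    (hchart x hx fun y => y i).1 (hol_affineSpace_apply i x)
  choose g hg hgφ using hex
  have hG : AnalyticAt ℂ (fun w i => g i w) (φ x) := AnalyticAt.pi hg
  have hleft : ∀ᶠ y in nhds x, (fun i => g i (φ y)) = y := by
    filter_upwards [Filter.eventually_all.2 hgφ] with y hy
    exact funext fun i => (hy i).symm
  have hGx : (fun i => g i (φ x)) = x := hleft.self_of_nhds
  -- points near `φ x` are images of points near `x`
  have hmap : nhds (φ x) ≤ Filter.map φ (nhds x) := by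
    have h1 : Filter.map (U.domRestrict φ) (nhds ⟨x, hx⟩) = nhds (φ x) := by
      have h : Topology.IsOpenEmbedding (U.domRestrict φ) :=
        ⟨hemb, by simpa [Set.range_domRestrict] using hopen⟩
      exact h.map_nhds_eq _
    rw [← h1, show U.domRestrict φ = φ ∘ Subtype.val from rfl, ← Filter.map_map]
    exact Filter.map_mono continuous_subtype_val.continuousAt
  have hright : ∀ᶠ w in nhds (φ x), φ (fun i => g i w) = w := by
    refine hmap (Filter.mem_map.2 ?_)
    filter_upwards [hleft] with y hy
    simp [hy]
  have hφ' : HasFDerivAt φ (fderiv ℂ φ x) (fun i => g i (φ x)) := by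
    rw [hGx]; exact hφ.differentiableAt.hasFDerivAt
  have hcomp := hφ'.comp (φ x) hG.differentiableAt.hasFDerivAt
  have hid := hcomp.unique ((hasFDerivAt_id (φ x)).congr_of_eventuallyEq hright)
  have hsurj : Function.Surjective (fderiv ℂ φ x) := fun v =>
    ⟨_, DFunLike.congr_fun hid v⟩
  simpa using LinearMap.finrank_le_finrank_of_surjective (f := (fderiv ℂ φ x).toLinearMap) hsurj

theorem hasDim_affineSpace : (affineSpace d).HasDim d :=
  ⟨⟨0, Set.univ, id, Set.mem_univ _, isHolChart_analyticAt_id, by simp⟩,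
    fun _ ⟨_, hx⟩ => le_of_isRegularPoint_affineSpace hx⟩

end Affine

/-! ### A map that is not a product of five factors -/

section LowerBound

variable {n : ℕ}

/-- If a block diagonal matrix is a product of five factors, then its lower right block minus the
identity is a product of two symmetric matrices, namely of the third and the fourth parameter. -/
theorem sub_one_eq_mul_of_prod_eq_fromBlocks {A B Z₁ Z₂ Z₃ Z₄ Z₅ : Matrix (Fin n) (Fin n) ℂ}
    (h : fromBlocks B 0 0 A = Mminus Z₁ * (Mplus Z₂ * (Mminus Z₃ * (Mplus Z₄ * Mminus Z₅)))) :
    A - 1 = Z₃ * Z₄ := by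
  -- Cancelling the outer lower factors leaves the lower right block A unchanged; on the other side
  -- that block is Z₃Z₄ + 1.
  have e : Mminus (-Z₁) * fromBlocks B 0 0 A * Mminus (-Z₅) = Mplus Z₂ * Mminus Z₃ * Mplus Z₄ := by
    have h1 : Mminus (-Z₁) * Mminus Z₁ = 1 := by simp [Mminus, fromBlocks_multiply]
    have h5 : Mminus Z₅ * Mminus (-Z₅) = 1 := by simp [Mminus, fromBlocks_multiply]
    calc _ = (Mminus (-Z₁) * Mminus Z₁) * Mplus Z₂ * Mminus Z₃ * Mplus Z₄ *
          (Mminus Z₅ * Mminus (-Z₅)) := by rw [h]; simp only [Matrix.mul_assoc]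
      _ = _ := by rw [h1, h5, Matrix.one_mul, Matrix.mul_one]
  simp only [Mminus, Mplus, fromBlocks_multiply, fromBlocks_inj] at e
  have := e.2.2.2
  simp at this
  rw [this]
  simp

/-- The matrix `z E₀₁ + z² E₁₂`. -/
def nilpotentFamily (m : ℕ) (z : ℂ) : Matrix (Fin (m + 3)) (Fin (m + 3)) ℂ :=
  single 0 1 z + single 1 2 (z ^ 2)

theorem fin_two_ne_zero_and_ne_one (m : ℕ) : (2 : Fin (m + 3)) ≠ 0 ∧ (2 : Fin (m + 3)) ≠ 1 := by
  have h : 2 % (m + 3) = 2 := Nat.mod_eq_of_lt (by omega)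
  simp [Fin.ext_iff, h]

theorem det_two_add_nilpotentFamily_ne_zero (m : ℕ) (z : ℂ) :
    (2 + nilpotentFamily m z).det ≠ 0 := by
  rw [← one_add_one_eq_two]
  rw [det_of_isUpperTriangular]
  · refine Finset.prod_ne_zero_iff.2 fun i _ => ?_
    rw [Matrix.add_apply, Matrix.add_apply, nilpotentFamily, Matrix.add_apply, single_apply_of_ne, single_apply_of_ne]
    · rw [one_apply_eq]
      norm_num
    · rintro ⟨rfl, h⟩
      exact (fin_two_ne_zero_and_ne_one m).2 h
    · rintro ⟨rfl, h⟩
      exact absurd h (by simp)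
  · intro i j h
    have h' : j < i := h
    rw [Matrix.add_apply, Matrix.add_apply, nilpotentFamily, Matrix.add_apply, single_apply_of_ne, single_apply_of_ne,
      one_apply_ne h'.ne']
    · simp
    · rintro ⟨rfl, rfl⟩
      have : 2 % (m + 3) = 2 := Nat.mod_eq_of_lt (by omega)
      simp [Fin.lt_def, this] at h'
    · rintro ⟨rfl, rfl⟩
      simp at h'

theorem nilpotentFamily_mul_apply_zero {m : ℕ} (z : ℂ) (V : Matrix (Fin (m + 3)) (Fin (m + 3)) ℂ)
    (j : Fin (m + 3)) : (nilpotentFamily m z * V) 0 j = z * V 1 j := by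
  rw [nilpotentFamily, Matrix.add_mul, Matrix.add_apply, single_mul_apply_same,
    single_mul_apply_of_ne _ _ _ _ _ (by simp), add_zero]

theorem nilpotentFamily_mul_apply_one {m : ℕ} (z : ℂ) (V : Matrix (Fin (m + 3)) (Fin (m + 3)) ℂ)
    (j : Fin (m + 3)) : (nilpotentFamily m z * V) 1 j = z ^ 2 * V 2 j := by
  rw [nilpotentFamily, Matrix.add_mul, Matrix.add_apply, single_mul_apply_same,
    single_mul_apply_of_ne _ _ _ _ _ (by simp), zero_add]

theorem nilpotentFamily_mul_apply_of_ne {m : ℕ} (z : ℂ) (V : Matrix (Fin (m + 3)) (Fin (m + 3)) ℂ)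
    {i : Fin (m + 3)} (h0 : i ≠ 0) (h1 : i ≠ 1) (j : Fin (m + 3)) :
    (nilpotentFamily m z * V) i j = 0 := by
  rw [nilpotentFamily, Matrix.add_mul, Matrix.add_apply, single_mul_apply_of_ne _ _ _ _ _ h0,
    single_mul_apply_of_ne _ _ _ _ _ h1, zero_add]

/-- Rows 0 and 1 of the product are z and z² times rows 1 and 2 of V, and all other rows vanish.
Comparing entries across the diagonal gives the claim. The unequal weights leave the factor z in V₁₁
= z V₂₀, which makes V₁₁ vanish in the limit z → 0. -/
theorem apply_of_isSymm_nilpotentFamily_mul {m : ℕ} {z : ℂ} (hz : z ≠ 0)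
    {V : Matrix (Fin (m + 3)) (Fin (m + 3)) ℂ} (hV : V.IsSymm)
    (h : (nilpotentFamily m z * V).IsSymm) {j : Fin (m + 3)} (hj : j ≠ 0) :
    V 1 j = (if j = 1 then z * V 2 0 else 0) ∧ V 2 j = 0 := by
  have off : ∀ j : Fin (m + 3), j ≠ 0 → j ≠ 1 → V 1 j = 0 ∧ V 2 j = 0 := by
    intro j h0 h1
    have e0 := h.apply 0 j
    have e1 := h.apply 1 j
    rw [nilpotentFamily_mul_apply_zero, nilpotentFamily_mul_apply_of_ne z V h0 h1] at e0
    rw [nilpotentFamily_mul_apply_one, nilpotentFamily_mul_apply_of_ne z V h0 h1] at e1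
    simpa [hz] using And.intro e0.symm e1.symm
  split_ifs with h1
  · subst h1
    have e := h.apply 0 1
    rw [nilpotentFamily_mul_apply_zero, nilpotentFamily_mul_apply_one] at e
    refine ⟨mul_left_cancel₀ hz (by rw [← e]; ring), ?_⟩
    rw [← hV.apply]
    exact (off 2 (fin_two_ne_zero_and_ne_one m).1 (fin_two_ne_zero_and_ne_one m).2).1
  · exact off j hj h1

/-- A continuous family of symmetric matrices that intertwines the family with its transpose is
singular at the origin. -/
theorem det_eq_zero_of_isSymm_nilpotentFamily_mul {m : ℕ}
    {V : ℂ → Matrix (Fin (m + 3)) (Fin (m + 3)) ℂ} (hc : ∀ i j, Continuous fun z => V z i j)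
    (hV : ∀ z, (V z).IsSymm) (h : ∀ z, (nilpotentFamily m z * V z).IsSymm) : (V 0).det = 0 := by
  -- The relations for z ≠ 0 extend to z = 0 by continuity. There rows 1 and 2 are both supported in
  -- column 0, hence linearly dependent.
  have heq : ∀ u v : ℂ → ℂ, Continuous u → Continuous v → (∀ z ≠ 0, u z = v z) → u 0 = v 0 := by
    intro u v hu hv huv
    exact congrFun (hu.ext_on (dense_compl_singleton 0) hv fun z hz => huv z hz) 0
  have h1 : ∀ j ≠ 0, V 0 1 j = 0 := by
    intro j hj
    have := heq (fun z => V z 1 j) (fun z => if j = 1 then z * V z 2 0 else 0) (hc _ _)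
      (by split_ifs; exacts [continuous_id.mul (hc _ _), continuous_const])
      fun z hz => (apply_of_isSymm_nilpotentFamily_mul hz (hV z) (h z) hj).1
    simpa using this
  have h2 : ∀ j ≠ 0, V 0 2 j = 0 := fun j hj =>
    heq (fun z => V z 2 j) (fun _ => 0) (hc _ _) continuous_const
      fun z hz => (apply_of_isSymm_nilpotentFamily_mul hz (hV z) (h z) hj).2
  by_cases h10 : V 0 1 0 = 0
  · refine det_eq_zero_of_row_eq_zero 1 fun j => ?_
    rcases eq_or_ne j 0 with rfl | hj
    exacts [h10, h1 j hj]
  · rw [← exists_vecMul_eq_zero_iff]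
    refine ⟨Pi.single 2 (V 0 1 0) - Pi.single 1 (V 0 2 0), fun h => ?_, ?_⟩
    · have := congrFun h 2
      simp [(fin_two_ne_zero_and_ne_one m).2] at this
      exact h10 this
    · ext j
      simp only [sub_vecMul, single_vecMul, Pi.sub_apply, Pi.smul_apply, smul_eq_mul, row_apply,
        Pi.zero_apply]
      rcases eq_or_ne j 0 with rfl | hj
      · ring
      · rw [h1 j hj, h2 j hj]; ring

theorem diagonalFactor_mem_symplecticGroup {A : Matrix (Fin n) (Fin n) ℂ} (hA : A.det ≠ 0) :
    diagonalFactor false A ∈ symplecticGroup (Fin n) ℂ := by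
  rw [SymplecticGroup.mem_iff, diagonalFactor, J, if_neg Bool.false_ne_true, fromBlocks_transpose]
  simp [fromBlocks_multiply, ← transpose_mul, mul_nonsing_inv _ hA.isUnit]

theorem not_sufficesOmega_five (m d : ℕ) (hd : 1 ≤ d) : ¬ SufficesOmega (m + 3) d 5 := by
  intro hS
  -- The diagonal entry 2 keeps both A and A - 1 invertible.
  let A : (Fin d → ℂ) → Matrix (Fin (m + 3)) (Fin (m + 3)) ℂ := fun x =>
    2 + nilpotentFamily m (x ⟨0, hd⟩)
  have hA0 : ∀ x, (A x).det ≠ 0 := fun x => det_two_add_nilpotentFamily_ne_zero m _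
  have hx := hol_affineSpace_apply (⟨0, hd⟩ : Fin d)
  have hsingle : ∀ (i j : Fin (m + 3)) {u : (Fin d → ℂ) → ℂ}, (affineSpace d).Hol u →
      (affineSpace d).HolMatrix fun x => single i j (u x) := by
    intro i j u hu k l
    simp only [single_apply]
    split_ifs
    exacts [hu, hol_const 0]
  have hA : (affineSpace d).HolMatrix A :=
    (holMatrix_const 2).add ((hsingle 0 1 hx).add (hsingle 1 2 (by simpa only [sq] using hx.mul hx)))
  have hD : (affineSpace d).HolMatrix fun x => diagonalFactor false (A x) := by
    intro i j
    rcases i with i | i <;> rcases j with j | j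
    · exact (hA.inv hA0).transpose i j
    · exact hol_const 0
    · exact hol_const 0
    · exact hA i j
  let f : C(Fin d → ℂ, symplecticGroup (Fin (m + 3)) ℂ) :=
    ⟨fun x => ⟨diagonalFactor false (A x), diagonalFactor_mem_symplecticGroup (hA0 x)⟩,
      Continuous.subtype_mk (continuous_matrix fun i j =>
        continuous_of_hol_affineSpace (hD i j)) _⟩
  have hf : f.Nullhomotopic := by
    -- Affine space is contractible.
    simpa using (id_nullhomotopic (Fin d → ℂ)).comp_right f
  have h5 := (factorsOmega_iff 5).1
    (hS _ (affineSpace d) isStein_affineSpace hasDim_affineSpace f hf hD)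
  obtain ⟨Z₁, g₁, -, -, ⟨Z₂, g₂, -, -, ⟨Z₃, g₃, hZ₃, hs₃, ⟨Z₄, g₄, -, hs₄, ⟨Z₅, g₅, -, -, h0, e₅⟩,
    e₄⟩, e₃⟩, e₂⟩, e₁⟩ := h5
  have h0' : ∀ x, g₅ x = 1 := h0
  have key : ∀ x, A x - 1 = Z₃ x * Z₄ x := by
    intro x
    refine sub_one_eq_mul_of_prod_eq_fromBlocks (B := ((A x)⁻¹)ᵀ) (Z₁ := Z₁ x) (Z₂ := Z₂ x)
      (Z₅ := Z₅ x) ?_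
    have := e₁ x
    simpa [e₂, e₃, e₄, e₅, h0', elementaryFactor, f, diagonalFactor] using this
  -- Restriction to the diagonal line in ℂᵈ reduces to one complex variable.
  have key' : ∀ z : ℂ, 1 + nilpotentFamily m z = Z₃ (fun _ => z) * Z₄ fun _ => z := by
    intro z
    rw [← key, show A (fun _ => z) = 2 + nilpotentFamily m z from rfl, ← one_add_one_eq_two]
    abel
  have hdet := det_eq_zero_of_isSymm_nilpotentFamily_mul (V := fun z => Z₃ fun _ => z)
    (fun i j => (continuous_of_hol_affineSpace (hZ₃ i j)).comp (by fun_prop)) (fun z => hs₃ _) ?_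
  · have := congrArg Matrix.det (key' 0)
    rw [det_mul, hdet, zero_mul] at this
    simp [nilpotentFamily] at this
  · intro z
    -- From 1 + N = Z₃Z₄ it follows that NZ₃ = Z₃Z₄Z₃ - Z₃, which is symmetric.
    have e : nilpotentFamily m z * Z₃ (fun _ => z) =
        Z₃ (fun _ => z) * Z₄ (fun _ => z) * Z₃ (fun _ => z) - Z₃ fun _ => z := by
      rw [← key']; noncomm_ring
    rw [e]
    refine IsSymm.sub ?_ (hs₃ _)
    rw [IsSymm, transpose_mul, transpose_mul, (hs₃ _).eq, (hs₄ _).eq, Matrix.mul_assoc]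

theorem six_le_ksymp {m d : ℕ} (hd : 1 ≤ d) : 6 ≤ Ksymp (m + 3) d := by
  refine le_iInf₂ fun K hK => ?_
  by_contra hlt
  have hK5 : K ≤ 5 := by
    have : K < 6 := by exact_mod_cast not_le.1 hlt
    omega
  refine not_sufficesOmega_five m d hd fun X _ 𝒪 hX hdim f hf hhol => ?_
  -- A shorter product is padded to five factors with zero parameters.
  exact (factorsOmega_iff 5).2 (((factorsOmega_iff K).1 (hK X 𝒪 hX hdim f hf hhol)).mono hK5)

end LowerBound

theorem theorem1p3 (n d : ℕ) :
    (4 ≤ n → (1 ≤ d → 6 ≤ Ksymp n d) ∧ Ksymp n d ≤ 7 * KsympTilde n d) ∧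
      (n = 2 ∨ n = 3 → Ksymp n d ≤ 4 * KsympTilde n d) := by
  refine ⟨fun hn => ?_, fun hn => ?_⟩
  · obtain ⟨m, rfl⟩ := Nat.exists_eq_add_of_le' (show 3 ≤ n by omega)
    refine ⟨six_le_ksymp, ?_⟩
    exact ksymp_le_mul_ksympTilde (c := 7) (by norm_num) fun K hK X _ 𝒪 hX hdim f hf hhol =>
      (hK X 𝒪 hX hdim f hf hhol).factorsOmega_seven
  · exact ksymp_le_mul_ksympTilde (c := 4) (by norm_num) fun K hK X _ 𝒪 hX hdim f hf hhol =>
      (hK X 𝒪 hX hdim f hf hhol).factorsOmega_four hn
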